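/- Let $\Bbbk$ be a field, let $r_1,r_2,r_3\ge 2$ and $t\in\{1,2,3\}$ be integers, and write $[m]=\{1,\dots,m\}$ and $\mathcal N=[r_1]\times[r_2]\times[r_3]$. Call $a,b\in\mathcal N$ $2$-equivalent if $a_1+a_2=b_1+b_2$ and $a_3=b_3$. Let $R=\Bbbk[x_a : a\in\mathcal N]$ be the polynomial ring with one variable for each $2$-equivalence class, so that $x_a=x_b$ if and only if $a$ and $b$ are $2$-equivalent. Let $d(a,b)$ be the number of components in which $a,b\in\mathcal N$ differ. For $i\in[3]$ let $\mathrm{sw}(i,a,b)$ be the index obtained from $a$ by replacing its $i$th component by $b_i$, and put $$f_{i,a,b}=x_ax_b-x_{\mathrm{sw}(i,a,b)}\,x_{\mathrm{sw}(i,b,a)} .$$ Define the ideals of $R$ $$I^{(2,t)}=\big(f_{i,a,b} : i\in[t],\ a,b\in\mathcal N,\ d(a,b)=2\big),\qquad \tilde I^{(2,t)}=\big(f_{i,a,b} : i\in[t],\ a,b\in\mathcal N\big).$$ A set $\mathcal S\subseteq\mathcal N$ is $(2,t)$-switchable if it is closed under $2$-equivalence and $\mathrm{sw}(i,a,b)\in\mathcal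 S$ whenever $i\in[t]$, $a,b\in\mathcal S$ and $d(a,b)=2$. Elements $a,b\in\mathcal S$ are connected in $\mathcal S$ if there are $a=c_0,c_1,\dots,c_k=b$ in $\mathcal S$ with $d(c_{j-1},c_j)=1$ for all $j\in[k]$. For such $\mathcal S$ put $$P^{(2,t)}_{\mathcal S}=\big(x_a : a\in\mathcal N\setminus\mathcal S\big)+\big(f_{i,a,b} : i\in[t],\ a,b \text{ connected in } \mathcal S\big).$$ For $\varphi:[r_3]\to\{(1,1),(r_1,r_2)\}$ let $\mathcal S^{\varphi}=\{a\in\mathcal N : (a_1,a_2)=\varphi(a_3)\}$. **Theorem.** For every non-constant $\varphi:[r_3]\to\{(1,1),(r_1,r_2)\}$ the set $\mathcal S^{\varphi}$ is $(2,t)$-switchable and the ideal $P^{(2,t)}_{\mathcal S^{\varphi}}$ is generated by monomials. The minimal primes of $I^{(2,t)}$ are exactly $\tilde I^{(2,t)}$ together with the ideals $P^{(2,t)}_{\mathcal S^{\varphi}}$, where $\varphi$ ranges over the non-constant functions $[r_3]\to\{(1,1),(r_1,r_2)\}$, and there are exactly $2^{r_3}-1$ of them. -/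

import Mathlib

namespace HankelHypermatrix

/-- The set of indices `[r_1] × ⋯ × [r_n]`, where `[m] = {1, …, m}`. The positions `1, …, n` of the
components are the elements `0, …, n - 1` of `Fin n`; the values of the components are 1-based. -/
abbrev Index {n : ℕ} (r : Fin n → ℕ) : Type := (i : Fin n) → Set.Icc 1 (r i)

/-- Two indices are `s`-equivalent if the sums of their first `s` components agree and all the
remaining components agree. -/
def sEquiv {n : ℕ} (r : Fin n → ℕ) (s : ℕ) : Setoid (Index r) where
  r a b :=
    (∑ i with i.val < s, (a i : ℕ)) = (∑ i with i.val < s, (b i : ℕ)) ∧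
      ∀ i : Fin n, s ≤ i.val → a i = b i
  iseqv :=
    { refl := fun _ => ⟨rfl, fun _ _ => rfl⟩
      symm := fun h => ⟨h.1.symm, fun i hi => (h.2 i hi).symm⟩
      trans := fun h h' => ⟨h.1.trans h'.1, fun i hi => (h.2 i hi).trans (h'.2 i hi)⟩ }

/-- The polynomial ring `R = 𝕜[x_a : a ∈ 𝒩]`, in which `x_a = x_b` exactly when `a` and `b` are
`s`-equivalent: it has one variable for each `s`-equivalence class. -/
abbrev HankelRing (𝕜 : Type*) [Field 𝕜] {n : ℕ} (r : Fin n → ℕ) (s : ℕ) : Type _ :=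
  MvPolynomial (Quotient (sEquiv r s)) 𝕜

/-- The entry `x_a` of the `s`-Hankel hypermatrix. -/
noncomputable def entry (𝕜 : Type*) [Field 𝕜] {n : ℕ} (r : Fin n → ℕ) (s : ℕ) (a : Index r) :
    HankelRing 𝕜 r s :=
  MvPolynomial.X (Quotient.mk (sEquiv r s) a)

/-- The switch `sw(L, a, b)`. -/
def sw {n : ℕ} {r : Fin n → ℕ} (L : Finset (Fin n)) (a b : Index r) : Index r :=
  fun i => if i ∈ L then b i else a i

/-- The generalized minor `f_{i,a,b} = x_a x_b - x_{sw(i,a,b)} x_{sw(i,b,a)}`. -/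
noncomputable def minor (𝕜 : Type*) [Field 𝕜] {n : ℕ} (r : Fin n → ℕ) (s : ℕ) (i : Fin n)
    (a b : Index r) : HankelRing 𝕜 r s :=
  entry 𝕜 r s a * entry 𝕜 r s b - entry 𝕜 r s (sw {i} a b) * entry 𝕜 r s (sw {i} b a)

/-- The ideal `I^{(s,t)}` generated by the slice minors `f_{i,a,b}`, with `d(a,b) = 2` and `i` among
the first `t` positions. -/
noncomputable def sliceIdeal (𝕜 : Type*) [Field 𝕜] {n : ℕ} (r : Fin n → ℕ) (s t : ℕ) :
    Ideal (HankelRing 𝕜 r s) :=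
  Ideal.span {p | ∃ (i : Fin n) (a b : Index r),
    i.val < t ∧ hammingDist a b = 2 ∧ p = minor 𝕜 r s i a b}

/-- The ideal `Ĩ^{(s,t)}` generated by all the generalized minors `f_{i,a,b}` with `i` among the
first `t` positions. -/
noncomputable def genIdeal (𝕜 : Type*) [Field 𝕜] {n : ℕ} (r : Fin n → ℕ) (s t : ℕ) :
    Ideal (HankelRing 𝕜 r s) :=
  Ideal.span {p | ∃ (i : Fin n) (a b : Index r), i.val < t ∧ p = minor 𝕜 r s i a b}

/-- `(s,t)`-switchable sets of indices. -/
def IsSwitchable {n : ℕ} {r : Fin n → ℕ} (s t : ℕ) (S : Set (Index r)) : Prop :=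
  (∀ a ∈ S, ∀ b ∈ S, hammingDist a b = 2 → ∀ i : Fin n, i.val < t → sw {i} a b ∈ S) ∧
    ∀ a ∈ S, ∀ b : Index r, (sEquiv r s) a b → b ∈ S

/-- Connectedness of two elements of `S` by a path in `S` whose consecutive members have Hamming
distance 1. -/
def ConnectedIn {n : ℕ} {r : Fin n → ℕ} (S : Set (Index r)) (a b : Index r) : Prop :=
  a ∈ S ∧ b ∈ S ∧
    Relation.ReflTransGen (fun c d : Index r => c ∈ S ∧ d ∈ S ∧ hammingDist c d = 1) a b

/-- The ideal `Ĩ^{(s,t)}_S`. -/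
noncomputable def genIdealOn (𝕜 : Type*) [Field 𝕜] {n : ℕ} (r : Fin n → ℕ) (s t : ℕ)
    (S : Set (Index r)) : Ideal (HankelRing 𝕜 r s) :=
  Ideal.span {p | ∃ (i : Fin n) (a b : Index r),
    i.val < t ∧ ConnectedIn S a b ∧ p = minor 𝕜 r s i a b}

/-- The ideal `Var_S` generated by the variables `x_a` with `a ∉ S`. -/
noncomputable def varIdeal (𝕜 : Type*) [Field 𝕜] {n : ℕ} (r : Fin n → ℕ) (s : ℕ)
    (S : Set (Index r)) : Ideal (HankelRing 𝕜 r s) :=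
  Ideal.span {p | ∃ a : Index r, a ∉ S ∧ p = entry 𝕜 r s a}

/-- The ideal `P^{(s,t)}_S = Var_S + Ĩ^{(s,t)}_S`. -/
noncomputable def primeIdeal (𝕜 : Type*) [Field 𝕜] {n : ℕ} (r : Fin n → ℕ) (s t : ℕ)
    (S : Set (Index r)) : Ideal (HankelRing 𝕜 r s) :=
  varIdeal 𝕜 r s S + genIdealOn 𝕜 r s t S

/-- An ideal of a polynomial ring is monomial if it is generated by monomials. -/
def IsMonomialIdeal {σ 𝕜 : Type*} [Field 𝕜] (J : Ideal (MvPolynomial σ 𝕜)) : Prop :=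
  ∃ M : Set (σ →₀ ℕ), J = Ideal.span ((fun m => MvPolynomial.monomial m (1 : 𝕜)) '' M)

/-- The functions `φ : [r_3] → {(1,1), (r_1,r_2)}`. -/
abbrev CornerMap (r : Fin 3 → ℕ) : Type :=
  Set.Icc 1 (r 2) → ({(1, 1), (r 0, r 1)} : Set (ℕ × ℕ))

/-- `φ` is not constant. -/
def CornerMap.NonConstant {r : Fin 3 → ℕ} (φ : CornerMap r) : Prop :=
  ¬ ∃ c, ∀ l, φ l = c

/-- The set `S^φ = {a ∈ 𝒩 : (a_1, a_2) = φ(a_3)}`. -/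
def cornerSet {r : Fin 3 → ℕ} (φ : CornerMap r) : Set (Index r) :=
  {a | ((a 0 : ℕ), (a 1 : ℕ)) = (φ (a 2) : ℕ × ℕ)}

end HankelHypermatrix

open HankelHypermatrix

/-! Arrange the variables by column `u = a₁ + a₂` and row `l = a₃`. The slice minors give all
exchange relations x_{u+1,l} x_{v,l} = x_{u,l} x_{v+1,l} within a row, and between rows the minors
on consecutive columns. Map to the domain R/Q for a prime Q containing them. By `row_trichotomy`, a
row has no zero entry, or only its first or only its last entry can survive. If some row has no
zero, cancellation (`exchange_of_ne_zero`) yields exchange between all rows; if all rows degenerate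
towards the same end, exchange is trivial. Otherwise the surviving ends define a non-constant φ, and
Q contains the variables outside S^φ. Exchange relations identify monomials with equal row multisets
and equal column sums, so the generalized minors generate the kernel of x_{u,l} ↦ α_l s^u, a prime
(`ker_param_le`). On S^φ all connected minors vanish, so P is generated by variables. These primes
are pairwise incomparable. -/

namespace HankelHypermatrix

/-! ### Exchange relations over a general commutative ring -/

/-- The exchange relations of a rational normal scroll follow from the minors of two Hankel
matrices with the same row indices. -/
theorem exchange_of_hankel {D : Type*} [CommRing D] {A B : ℕ} (hA : 2 ≤ A) (hB : 2 ≤ B)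
    (y z : ℕ → D)
    (H : ∀ a₁ ∈ Set.Icc 1 A, ∀ b₁ ∈ Set.Icc 1 A, ∀ a₂ ∈ Set.Icc 1 B, ∀ b₂ ∈ Set.Icc 1 B,
      y (a₁ + a₂) * z (b₁ + b₂) = y (b₁ + a₂) * z (a₁ + b₂))
    {u v : ℕ} (hu : u ∈ Set.Ico 2 (A + B)) (hv : v ∈ Set.Ico 2 (A + B)) :
    y (u + 1) * z v = y u * z (v + 1) := by
  simp only [Set.mem_Icc, Set.mem_Ico] at *
  have H' : ∀ a₁ b₁ a₂ b₂ p q p' q' : ℕ, 1 ≤ a₁ → a₁ ≤ A → 1 ≤ b₁ → b₁ ≤ A → 1 ≤ a₂ → a₂ ≤ B →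
      1 ≤ b₂ → b₂ ≤ B → a₁ + a₂ = p → b₁ + b₂ = q → b₁ + a₂ = p' → a₁ + b₂ = q' →
      y p * z q = y p' * z q' := by
    rintro a₁ b₁ a₂ b₂ _ _ _ _ h1 h2 h3 h4 h5 h6 h7 h8 rfl rfl rfl rfl
    exact H a₁ ⟨h1, h2⟩ b₁ ⟨h3, h4⟩ a₂ ⟨h5, h6⟩ b₂ ⟨h7, h8⟩
  by_cases h1 : u + B ≤ v
  · -- both sides equal `y (v + 2 - B) * z (u + B - 1)`
    refine (H' u (v + 1 - B) 1 (B - 1) _ _ (v + 2 - B) (u + B - 1) ?_ ?_ ?_ ?_ ?_ ?_ ?_ ?_ ?_ ?_ ?_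
      ?_).trans
      (H' (u - 1) (v + 1 - B) 1 B _ _ (v + 2 - B) (u + B - 1) ?_ ?_ ?_ ?_ ?_ ?_ ?_ ?_ ?_ ?_ ?_
        ?_).symm <;> omega
  by_cases h2 : v + B ≤ u
  · refine (H' (u + 1 - B) (v - 1) B 1 _ _ (v - 1 + B) (u + 2 - B) ?_ ?_ ?_ ?_ ?_ ?_ ?_ ?_ ?_ ?_ ?_
      ?_).trans
      (H' (u + 1 - B) v (B - 1) 1 _ _ (v - 1 + B) (u + 2 - B) ?_ ?_ ?_ ?_ ?_ ?_ ?_ ?_ ?_ ?_ ?_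
        ?_).symm <;> omega
  -- With `u` and `v` less than `B` apart, one minor suffices: this is the least row index for which
  -- `u - b` and `v - b` are at most `B`.
  obtain ⟨b, hb⟩ : ∃ b, b = max 1 (max (v - B) (u - B)) := ⟨_, rfl⟩
  refine H' (b + 1) b (u - b) (v - b) _ _ _ _ ?_ ?_ ?_ ?_ ?_ ?_ ?_ ?_ ?_ ?_ ?_ ?_ <;> omega

/-- Modulo exchange relations, a product depends only on the rows and the sum of the columns. -/
theorem prod_eq_of_exchange {D L ι : Type*} [CommRing D] [Fintype ι] {M : ℕ} (Y : ℕ → L → D)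
    (hY : ∀ l l' : L, ∀ u ∈ Set.Ico 2 M, ∀ v ∈ Set.Ico 2 M,
      Y (u + 1) l * Y v l' = Y u l * Y (v + 1) l')
    (l : ι → L) (n : ℕ) (u v : ι → ℕ) (hu : ∀ i, u i ∈ Set.Icc 2 M) (hv : ∀ i, v i ∈ Set.Icc 2 M)
    (hsum : ∑ i, u i = ∑ i, v i) (hn : ∑ i, Nat.dist (u i) (v i) = n) :
    ∏ i, Y (u i) (l i) = ∏ i, Y (v i) (l i) := by
  classical
  induction n using Nat.strong_induction_on generalizing u with
  | _ n ih =>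
    by_cases huv : u = v
    · rw [huv]
    obtain ⟨i, hi⟩ : ∃ i, v i < u i := by
      by_contra! h
      exact huv (funext fun i =>
        (Finset.sum_eq_sum_iff_of_le fun i _ => h i).1 hsum i (Finset.mem_univ i))
    obtain ⟨j, hj⟩ : ∃ j, u j < v j := by
      by_contra! h
      exact huv (funext fun i =>
        ((Finset.sum_eq_sum_iff_of_le fun i _ => h i).1 hsum.symm i (Finset.mem_univ i)).symm)
    have hij : j ≠ i := by rintro rfl; omega
    have hje : j ∈ (Finset.univ : Finset ι).erase i := Finset.mem_erase.2 ⟨hij, Finset.mem_univ j⟩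
    -- One exchange moves a unit from an excessive column to a deficient one; the total distance to
    -- `v` drops by 2.
    obtain ⟨w, hw⟩ : ∃ w, w = Function.update (Function.update u i (u i - 1)) j (u j + 1) :=
      ⟨_, rfl⟩
    have hwi : w i = u i - 1 := by simp [hw, hij.symm]
    have hwj : w j = u j + 1 := by simp [hw]
    have hwk : ∀ k ∈ ((Finset.univ : Finset ι).erase i).erase j, w k = u k := by
      intro k hk
      simp only [Finset.mem_erase] at hk
      simp [hw, hk.1, hk.2.1]
    have hui := hu i
    have huj := hu j
    have hvi := hv i
    have hvj := hv j
    simp only [Set.mem_Icc] at hui huj hvi hvj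
    have hprod : ∏ k, Y (u k) (l k) = ∏ k, Y (w k) (l k) := by
      rw [← Finset.mul_prod_erase _ _ (Finset.mem_univ i), ← Finset.mul_prod_erase _ _ hje,
        ← Finset.mul_prod_erase _ (fun k => Y (w k) (l k)) (Finset.mem_univ i),
        ← Finset.mul_prod_erase _ (fun k => Y (w k) (l k)) hje, ← mul_assoc, ← mul_assoc,
        Finset.prod_congr rfl (fun k hk => show Y (w k) (l k) = Y (u k) (l k) by rw [hwk k hk]),
        hwi, hwj]
      congr 1
      have := hY (l i) (l j) (u i - 1) ⟨by omega, by omega⟩ (u j) ⟨by omega, by omega⟩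
      rwa [Nat.sub_add_cancel (by omega)] at this
    have hsplit : ∀ f : ι → ℕ, ∑ k, f k = f i + (f j + ∑ k ∈ (Finset.univ.erase i).erase j, f k) :=
      fun f => by
        rw [Finset.add_sum_erase _ _ hje, Finset.add_sum_erase _ _ (Finset.mem_univ i)]
    rw [hprod]
    have hrest : ∑ k ∈ (Finset.univ.erase i).erase j, w k =
        ∑ k ∈ (Finset.univ.erase i).erase j, u k := Finset.sum_congr rfl hwk
    have hrest' : ∑ k ∈ (Finset.univ.erase i).erase j, Nat.dist (w k) (v k) =
        ∑ k ∈ (Finset.univ.erase i).erase j, Nat.dist (u k) (v k) :=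
      Finset.sum_congr rfl fun k hk => by rw [hwk k hk]
    refine ih _ ?_ w ?_ ?_ rfl
    · rw [← hn, hsplit, hsplit (fun k => Nat.dist (u k) (v k)), hrest', hwi, hwj]
      simp only [Nat.dist]
      omega
    · intro k
      by_cases hk : k = j
      · subst hk; rw [hwj]; exact ⟨by omega, by omega⟩
      by_cases hk' : k = i
      · subst hk'; rw [hwi]; exact ⟨by omega, by omega⟩
      rw [hwk k (by simp [hk, hk'])]
      exact hu k
    · rw [← hsum, hsplit, hsplit u, hrest, hwi, hwj]
      omega

/-- A row satisfying the exchange relations in a domain has no zero entry, or at most one nonzero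
entry, which is the first or the last one. -/
theorem row_trichotomy {D : Type*} [CommRing D] [IsDomain D] {M : ℕ} (hM : 4 ≤ M) (y : ℕ → D)
    (hy : ∀ u ∈ Set.Ico 2 M, ∀ v ∈ Set.Ico 2 M, y (u + 1) * y v = y u * y (v + 1)) :
    (∀ u ∈ Set.Icc 2 M, y u ≠ 0) ∨ (∀ u ∈ Set.Ioc 2 M, y u = 0) ∨ ∀ u ∈ Set.Ico 2 M, y u = 0 := by
  simp only [Set.mem_Icc, Set.mem_Ico, Set.mem_Ioc, and_imp] at *
  -- Zeros spread through the interior by y_{u+1}² = y_u y_{u+2}; then y_2 y_M = y_3 y_{M-1} = 0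
  -- kills an end.
  by_cases h3 : y 3 = 0
  · right
    have hint : ∀ u, 3 ≤ u → u < M → y u = 0 := by
      intro u hu
      induction u, hu using Nat.le_induction with
      | base => exact fun _ => h3
      | succ u hu ih =>
        intro h
        have := hy u (by omega) (by omega) (u + 1) (by omega) h
        rw [ih (by omega), zero_mul] at this
        simpa using this
    have h := hy 2 le_rfl (by omega) (M - 1) (by omega) (by omega)
    rw [Nat.sub_add_cancel (by omega), h3, zero_mul, eq_comm, mul_eq_zero] at h
    rcases h with h | h
    · right
      intro u hu hu'
      rcases hu.eq_or_lt with rfl | hu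
      exacts [h, hint u hu hu']
    · left
      intro u hu hu'
      rcases hu'.eq_or_lt with rfl | hu'
      exacts [h, hint u hu hu']
  · left
    have h2 : y 2 ≠ 0 := by
      intro h2
      have := hy 2 le_rfl (by omega) 3 (by omega) (by omega)
      rw [h2, zero_mul] at this
      simp_all
    intro u hu
    induction u, hu using Nat.le_induction with
    | base => exact fun _ => h2
    | succ u hu ih =>
      intro h h0
      have := hy u hu h 2 le_rfl (by omega)
      rw [h0, zero_mul, eq_comm, mul_eq_zero] at this
      exact this.elim (ih (by omega)) h3

/-- If one row has no zero entry, then the exchange relations within rows and the minors on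
consecutive columns imply all exchange relations. -/
theorem exchange_of_ne_zero {D L : Type*} [CommRing D] [IsDomain D] {M : ℕ} (hM : 4 ≤ M)
    (Y : ℕ → L → D)
    (hrow : ∀ l : L, ∀ u ∈ Set.Ico 2 M, ∀ v ∈ Set.Ico 2 M,
      Y (u + 1) l * Y v l = Y u l * Y (v + 1) l)
    (hcol : ∀ l l' : L, ∀ u ∈ Set.Ico 2 M, Y u l * Y (u + 1) l' = Y (u + 1) l * Y u l')
    {l₀ : L} (h₀ : ∀ u ∈ Set.Icc 2 M, Y u l₀ ≠ 0) (l l' : L) {u v : ℕ}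
    (hu : u ∈ Set.Ico 2 M) (hv : v ∈ Set.Ico 2 M) :
    Y (u + 1) l * Y v l' = Y u l * Y (v + 1) l' := by
  -- Every row is geometric with the ratio of row `l₀`, written without division.
  have key : ∀ l : L, ∀ u ∈ Set.Ico 2 M, Y (u + 1) l * Y 2 l₀ = Y u l * Y 3 l₀ := by
    intro l u hu
    apply mul_left_cancel₀ (h₀ u ⟨hu.1, hu.2.le⟩)
    linear_combination Y 2 l₀ * hcol l₀ l u hu + Y u l * hrow l₀ u hu 2 ⟨le_rfl, by omega⟩
  apply mul_left_cancel₀ (h₀ 2 ⟨le_rfl, by omega⟩)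
  linear_combination Y v l' * key l u hu - Y u l * key l' v hv

/-! ### Column and row coordinates -/

open MvPolynomial

variable {𝕜 : Type*} [Field 𝕜] {r : Fin 3 → ℕ}

/-- The index `(i, j, l)`. -/
def mkIndex (i : Set.Icc 1 (r 0)) (j : Set.Icc 1 (r 1)) (l : Set.Icc 1 (r 2)) : Index r
  | 0 => i
  | 1 => j
  | 2 => l

@[simp] theorem mkIndex_zero (i : Set.Icc 1 (r 0)) (j : Set.Icc 1 (r 1)) (l : Set.Icc 1 (r 2)) :
    mkIndex i j l 0 = i := rfl

@[simp] theorem mkIndex_one (i : Set.Icc 1 (r 0)) (j : Set.Icc 1 (r 1)) (l : Set.Icc 1 (r 2)) :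
    mkIndex i j l 1 = j := rfl

@[simp] theorem mkIndex_two (i : Set.Icc 1 (r 0)) (j : Set.Icc 1 (r 1)) (l : Set.Icc 1 (r 2)) :
    mkIndex i j l 2 = l := rfl

theorem sum_lt_two (a : Index r) :
    (∑ i : Fin 3 with i.val < 2, (a i : ℕ)) = (a 0 : ℕ) + a 1 := by
  simp [Finset.sum_filter, Fin.sum_univ_three]

theorem sEquiv_two_iff {a b : Index r} :
    (sEquiv r 2) a b ↔ (a 0 : ℕ) + a 1 = (b 0 : ℕ) + b 1 ∧ a 2 = b 2 := by
  change ((∑ i : Fin 3 with i.val < 2, (a i : ℕ)) = (∑ i : Fin 3 with i.val < 2, (b i : ℕ)) ∧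
      ∀ i : Fin 3, 2 ≤ i.val → a i = b i) ↔ _
  rw [sum_lt_two, sum_lt_two]
  simp [Fin.forall_fin_succ]

theorem hammingDist_eq (a b : Index r) :
    hammingDist a b = (if a 0 ≠ b 0 then 1 else 0) + (if a 1 ≠ b 1 then 1 else 0) +
      if a 2 ≠ b 2 then 1 else 0 := by
  rw [hammingDist, Finset.card_filter, Fin.sum_univ_three]

/-- The sum of the first two components. -/
def column : Quotient (sEquiv r 2) → ℕ :=
  Quotient.lift (fun a => (a 0 : ℕ) + a 1) fun _ _ h => (sEquiv_two_iff.1 h).1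

/-- The third component. -/
def row : Quotient (sEquiv r 2) → Set.Icc 1 (r 2) :=
  Quotient.lift (fun a => a 2) fun _ _ h => (sEquiv_two_iff.1 h).2

theorem column_mem (q : Quotient (sEquiv r 2)) : column q ∈ Set.Icc 2 (r 0 + r 1) := by
  induction q using Quotient.inductionOn with
  | h a =>
    have h0 := (a 0).2
    have h1 := (a 1).2
    simp only [Set.mem_Icc] at h0 h1
    change (a 0 : ℕ) + a 1 ∈ _
    exact ⟨by omega, by omega⟩

open Classical in
/-- The variable in column `u` and row `l`, where columns are numbered from `2` to `r₁ + r₂`. -/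
noncomputable def cell (𝕜 : Type*) [Field 𝕜] {r : Fin 3 → ℕ} (u : ℕ) (l : Set.Icc 1 (r 2)) :
    HankelRing 𝕜 r 2 :=
  if h : ∃ q : Quotient (sEquiv r 2), column q = u ∧ row q = l then X h.choose else 0

theorem X_eq_cell (q : Quotient (sEquiv r 2)) :
    (X q : HankelRing 𝕜 r 2) = cell 𝕜 (column q) (row q) := by
  have h : ∃ q' : Quotient (sEquiv r 2), column q' = column q ∧ row q' = row q := ⟨q, rfl, rfl⟩
  rw [cell, dif_pos h]
  congr 1
  have hc := h.choose_spec
  revert hc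
  generalize h.choose = q'
  induction q using Quotient.inductionOn
  induction q' using Quotient.inductionOn
  exact fun hc => Quotient.sound (sEquiv_two_iff.2 ⟨hc.1.symm, hc.2.symm⟩)

theorem entry_eq_cell (a : Index r) : entry 𝕜 r 2 a = cell 𝕜 ((a 0 : ℕ) + a 1) (a 2) :=
  X_eq_cell _

theorem minor_zero_mkIndex (a b : Set.Icc 1 (r 0)) (a' b' : Set.Icc 1 (r 1))
    (l l' : Set.Icc 1 (r 2)) :
    minor 𝕜 r 2 0 (mkIndex a a' l) (mkIndex b b' l') =
      cell 𝕜 ((a : ℕ) + a') l * cell 𝕜 ((b : ℕ) + b') l' -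
        cell 𝕜 ((b : ℕ) + a') l * cell 𝕜 ((a : ℕ) + b') l' := by
  simp [minor, entry_eq_cell, sw]

/-! ### From minors to exchange relations -/

section Exchange

variable {t : ℕ} {D : Type*} [CommRing D]

/-- The exchange relations hold for the images of the variables. -/
def Exchange (f : HankelRing 𝕜 r 2 →+* D) : Prop :=
  ∀ l l' : Set.Icc 1 (r 2), ∀ u ∈ Set.Ico 2 (r 0 + r 1), ∀ v ∈ Set.Ico 2 (r 0 + r 1),
    f (cell 𝕜 (u + 1) l) * f (cell 𝕜 v l') = f (cell 𝕜 u l) * f (cell 𝕜 (v + 1) l')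

theorem exchange_of_genIdeal_le (hr : ∀ i, 2 ≤ r i) (ht : 1 ≤ t) (f : HankelRing 𝕜 r 2 →+* D)
    (hf : genIdeal 𝕜 r 2 t ≤ RingHom.ker f) : Exchange f := by
  intro l l' u hu v hv
  refine exchange_of_hankel (hr 0) (hr 1) (fun u => f (cell 𝕜 u l)) (fun u => f (cell 𝕜 u l')) ?_
    hu hv
  intro a ha b hb a' ha' b' hb'
  have := hf (Ideal.subset_span ⟨0, mkIndex ⟨a, ha⟩ ⟨a', ha'⟩ l, mkIndex ⟨b, hb⟩ ⟨b', hb'⟩ l',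
    ht, rfl⟩)
  rw [minor_zero_mkIndex, RingHom.mem_ker, map_sub, map_mul, map_mul] at this
  exact sub_eq_zero.1 this

theorem row_exchange_of_sliceIdeal_le (hr : ∀ i, 2 ≤ r i) (ht : 1 ≤ t)
    (f : HankelRing 𝕜 r 2 →+* D) (hf : sliceIdeal 𝕜 r 2 t ≤ RingHom.ker f) (l : Set.Icc 1 (r 2))
    (u : ℕ) (hu : u ∈ Set.Ico 2 (r 0 + r 1)) (v : ℕ) (hv : v ∈ Set.Ico 2 (r 0 + r 1)) :
    f (cell 𝕜 (u + 1) l) * f (cell 𝕜 v l) = f (cell 𝕜 u l) * f (cell 𝕜 (v + 1) l) := by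
  refine exchange_of_hankel (hr 0) (hr 1) (fun u => f (cell 𝕜 u l)) (fun u => f (cell 𝕜 u l)) ?_
    hu hv
  intro a ha b hb a' ha' b' hb'
  by_cases h1 : a = b
  · subst h1; rfl
  by_cases h2 : a' = b'
  · subst h2; exact mul_comm _ _
  have := hf (Ideal.subset_span ⟨0, mkIndex ⟨a, ha⟩ ⟨a', ha'⟩ l, mkIndex ⟨b, hb⟩ ⟨b', hb'⟩ l,
    ht, by simp [hammingDist_eq, h1, h2], rfl⟩)
  rw [minor_zero_mkIndex, RingHom.mem_ker, map_sub, map_mul, map_mul] at this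
  exact sub_eq_zero.1 this

/-- These are the slice minors of indices differing in the first component, by one, and in the
third. -/
theorem consecutive_of_sliceIdeal_le (hr : ∀ i, 2 ≤ r i) (ht : 1 ≤ t)
    (f : HankelRing 𝕜 r 2 →+* D) (hf : sliceIdeal 𝕜 r 2 t ≤ RingHom.ker f)
    (l l' : Set.Icc 1 (r 2)) (u : ℕ) (hu : u ∈ Set.Ico 2 (r 0 + r 1)) :
    f (cell 𝕜 u l) * f (cell 𝕜 (u + 1) l') = f (cell 𝕜 (u + 1) l) * f (cell 𝕜 u l') := by
  by_cases hl : l = l'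
  · subst hl; exact mul_comm _ _
  have h0 := hr 0
  have h1 := hr 1
  obtain ⟨a, b, ha, hb, rfl⟩ : ∃ a b, a ∈ Set.Ico 1 (r 0) ∧ b ∈ Set.Icc 1 (r 1) ∧ a + b = u := by
    simp only [Set.mem_Ico, Set.mem_Icc] at hu ⊢
    exact ⟨max 1 (u - r 1), u - max 1 (u - r 1), by omega, by omega, by omega⟩
  have := hf (Ideal.subset_span ⟨0, mkIndex ⟨a, ha.1, ha.2.le⟩ ⟨b, hb⟩ l,
    mkIndex ⟨a + 1, Nat.le_add_left _ _, ha.2⟩ ⟨b, hb⟩ l', ht, by simp [hammingDist_eq, hl, Subtype.ext_iff], rfl⟩)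
  rw [minor_zero_mkIndex, RingHom.mem_ker, map_sub, map_mul, map_mul] at this
  have h := sub_eq_zero.1 this
  simpa only [add_right_comm a 1 b] using h

end Exchange

/-! ### The toric prime -/

section Toric

/-- The exponent of the image of a variable under the parametrization `x_a ↦ α_{a₃} s^{a₁ + a₂}`. -/
noncomputable def exponent (q : Quotient (sEquiv r 2)) : Option (Set.Icc 1 (r 2)) →₀ ℕ :=
  Finsupp.single (some (row q)) 1 + Finsupp.single none (column q)

/-- The parametrization `x_a ↦ α_{a₃} s^{a₁ + a₂}`. -/
noncomputable def param (𝕜 : Type*) [Field 𝕜] (r : Fin 3 → ℕ) :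
    HankelRing 𝕜 r 2 →ₐ[𝕜] MvPolynomial (Option (Set.Icc 1 (r 2))) 𝕜 :=
  aeval fun q => monomial (exponent q) 1

theorem param_entry (a : Index r) :
    param 𝕜 r (entry 𝕜 r 2 a) = X (some (a 2)) * X none ^ ((a 0 : ℕ) + a 1) := by
  rw [param, entry, aeval_X, exponent, ← one_mul (1 : 𝕜), ← monomial_mul, X_pow_eq_monomial]
  rfl

theorem param_entry_ne_zero (a : Index r) : param 𝕜 r (entry 𝕜 r 2 a) ≠ 0 := by
  rw [param_entry]
  exact mul_ne_zero (X_ne_zero _) (pow_ne_zero _ (X_ne_zero _))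

theorem genIdeal_le_ker_param (t : ℕ) : genIdeal 𝕜 r 2 t ≤ RingHom.ker (param 𝕜 r) := by
  refine Ideal.span_le.2 ?_
  rintro _ ⟨i, a, b, -, rfl⟩
  rw [SetLike.mem_coe, RingHom.mem_ker, minor, map_sub, map_mul, map_mul]
  simp only [param_entry]
  fin_cases i <;> simp [sw] <;> ring

theorem exists_pairs_of_rel {α β : Type*} {R : α → β → Prop} {s : Multiset α} {t : Multiset β}
    (h : Multiset.Rel R s t) :
    ∃ N : Multiset (α × β), (∀ p ∈ N, R p.1 p.2) ∧ N.map Prod.fst = s ∧ N.map Prod.snd = t := by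
  induction h with
  | zero => exact ⟨0, by simp⟩
  | @cons a b s t hab _ ih =>
    obtain ⟨N, hN, rfl, rfl⟩ := ih
    refine ⟨(a, b) ::ₘ N, ?_, by simp, by simp⟩
    intro p hp
    rcases Multiset.mem_cons.1 hp with rfl | hp
    exacts [hab, hN p hp]

theorem sum_exponent_some (s : Multiset (Quotient (sEquiv r 2))) (l : Set.Icc 1 (r 2)) :
    (s.map exponent).sum (some l) = (s.map row).count l := by
  induction s using Multiset.induction_on with
  | empty => simp
  | cons q s ih =>
    simp [exponent, ih, Multiset.count_cons, Finsupp.single_apply, add_comm, eq_comm]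

theorem sum_exponent_none (s : Multiset (Quotient (sEquiv r 2))) :
    (s.map exponent).sum none = (s.map column).sum := by
  induction s using Multiset.induction_on with
  | empty => simp
  | cons q s ih => simp [exponent, ih]

/-- Equal exponents mean equal row multisets and column sums. Pairing the variables by row reduces
this to `prod_eq_of_exchange`. -/
theorem prod_map_X_eq {D : Type*} [CommRing D] {f : HankelRing 𝕜 r 2 →+* D} (hf : Exchange f)
    {s s' : Multiset (Quotient (sEquiv r 2))}
    (h : (s.map exponent).sum = (s'.map exponent).sum) :
    (s.map fun q => f (X q)).prod = (s'.map fun q => f (X q)).prod := by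
  have hrow : s.map row = s'.map row := by
    ext l
    rw [← sum_exponent_some, ← sum_exponent_some, h]
  have hcol : (s.map column).sum = (s'.map column).sum := by
    rw [← sum_exponent_none, ← sum_exponent_none, h]
  rw [← Multiset.rel_eq, Multiset.rel_map] at hrow
  obtain ⟨N, hN, rfl, rfl⟩ := exists_pairs_of_rel hrow
  obtain ⟨N, rfl⟩ : ∃ l : List (_ × _), Multiset.ofList l = N := Quot.exists_rep N
  have := prod_eq_of_exchange (fun u l => f (cell 𝕜 u l)) hf
    (fun i : Fin N.length => row N[i].1) _ (fun i => column N[i].1) (fun i => column N[i].2)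
    (fun _ => column_mem _) (fun _ => column_mem _) ?_ rfl
  · simp only [Multiset.map_coe, Multiset.prod_coe, List.map_map]
    rw [← Fin.prod_univ_fun_getElem, ← Fin.prod_univ_fun_getElem]
    simp only [Function.comp_apply, X_eq_cell]
    refine this.trans (Finset.prod_congr rfl fun i _ => ?_)
    rw [hN N[i] (List.getElem_mem _)]
    rfl
  · simp only [Multiset.map_coe, Multiset.sum_coe, List.map_map,
      ← Fin.sum_univ_fun_getElem] at hcol
    exact hcol

theorem monomial_eq_prod_map_X (m : Quotient (sEquiv r 2) →₀ ℕ) :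
    (monomial m 1 : HankelRing 𝕜 r 2) = ((Finsupp.toMultiset m).map X).prod := by
  rw [monomial_eq, C_1, one_mul, Finsupp.toMultiset_map, Finsupp.prod_toMultiset,
    Finsupp.prod_mapDomain_index (by simp) (by simp [pow_add])]

theorem param_monomial (m : Quotient (sEquiv r 2) →₀ ℕ) :
    param 𝕜 r (monomial m 1) = monomial ((Finsupp.toMultiset m).map exponent).sum 1 := by
  rw [monomial_eq_prod_map_X, map_multiset_prod, Multiset.map_map]
  induction Finsupp.toMultiset m using Multiset.induction_on with
  | empty => simp
  | cons q s ih =>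
    rw [Multiset.map_cons, Multiset.prod_cons, ih, Multiset.map_cons, Multiset.sum_cons]
    simp [param, monomial_mul]

theorem ker_param_le {D : Type*} [CommRing D] {f : HankelRing 𝕜 r 2 →+* D} (hf : Exchange f) :
    RingHom.ker (param 𝕜 r) ≤ RingHom.ker f := by
  classical
  let e : (Quotient (sEquiv r 2) →₀ ℕ) → Option (Set.Icc 1 (r 2)) →₀ ℕ :=
    fun m => ((Finsupp.toMultiset m).map exponent).sum
  let _ : Algebra 𝕜 D := (f.comp C).toAlgebra
  let g : HankelRing 𝕜 r 2 →ₗ[𝕜] D := ({ f with commutes' := fun _ => rfl } : _ →ₐ[𝕜] D).toLinearMap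
  -- A linear factorization of `f` through `param` is enough: choose a preimage of each monomial in
  -- the image, and send the other monomials to 0.
  let σ : MvPolynomial (Option (Set.Icc 1 (r 2))) 𝕜 →ₗ[𝕜] D :=
    (basisMonomials _ 𝕜).constr 𝕜 fun d =>
      if h : ∃ m, e m = d then f (monomial h.choose 1) else 0
  have hσ : σ ∘ₗ (param 𝕜 r).toLinearMap = g := by
    refine (basisMonomials _ 𝕜).ext fun m => ?_
    have h : ∃ m', e m' = e m := ⟨m, rfl⟩
    have h1 : σ (monomial (e m) 1) = f (monomial h.choose 1) := by
      have := (basisMonomials _ 𝕜).constr_basis 𝕜 (fun d =>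
        if h : ∃ m, e m = d then f (monomial h.choose 1) else 0) (e m)
      rwa [coe_basisMonomials, dif_pos h] at this
    rw [coe_basisMonomials, LinearMap.comp_apply, AlgHom.toLinearMap_apply, param_monomial]
    refine h1.trans ?_
    change _ = f (monomial m 1)
    rw [monomial_eq_prod_map_X, monomial_eq_prod_map_X, map_multiset_prod, map_multiset_prod,
      Multiset.map_map, Multiset.map_map]
    exact prod_map_X_eq hf h.choose_spec
  intro p hp
  have : g p = 0 := by
    rw [← hσ, LinearMap.comp_apply, AlgHom.toLinearMap_apply, RingHom.mem_ker.1 hp, map_zero]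
  exact this

theorem genIdeal_eq_ker_param (hr : ∀ i, 2 ≤ r i) {t : ℕ} (ht : 1 ≤ t) :
    genIdeal 𝕜 r 2 t = RingHom.ker (param 𝕜 r) := by
  refine (genIdeal_le_ker_param t).antisymm ?_
  have h := exchange_of_genIdeal_le hr ht (Ideal.Quotient.mk (genIdeal 𝕜 r 2 t))
    (Ideal.mk_ker).ge
  exact (ker_param_le h).trans Ideal.mk_ker.le

theorem isPrime_genIdeal (hr : ∀ i, 2 ≤ r i) {t : ℕ} (ht : 1 ≤ t) :
    (genIdeal 𝕜 r 2 t).IsPrime := by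
  rw [genIdeal_eq_ker_param hr ht]
  exact RingHom.ker_isPrime _

end Toric

variable {t : ℕ}

theorem sliceIdeal_le_genIdeal : sliceIdeal 𝕜 r 2 t ≤ genIdeal 𝕜 r 2 t :=
  Ideal.span_mono fun _ ⟨i, a, b, hi, _, h⟩ => ⟨i, a, b, hi, h⟩

/-! ### The monomial primes -/

section Corner

theorem mem_cornerSet {φ : CornerMap r} {a : Index r} :
    a ∈ cornerSet φ ↔ ((a 0 : ℕ), (a 1 : ℕ)) = (φ (a 2) : ℕ × ℕ) := Iff.rfl

theorem corner_cases {a : Index r} {φ : CornerMap r} (ha : a ∈ cornerSet φ) :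
    ((φ (a 2) : ℕ × ℕ) = (1, 1) ∧ (a 0 : ℕ) = 1 ∧ (a 1 : ℕ) = 1) ∨
      ((φ (a 2) : ℕ × ℕ) = (r 0, r 1) ∧ (a 0 : ℕ) = r 0 ∧ (a 1 : ℕ) = r 1) := by
  rw [mem_cornerSet] at ha
  rcases (φ (a 2)).2 with h | h
  · rw [h, Prod.mk.injEq] at ha
    exact Or.inl ⟨h, ha⟩
  · rw [Set.mem_singleton_iff] at h
    rw [h, Prod.mk.injEq] at ha
    exact Or.inr ⟨h, ha⟩

theorem mem_cornerSet_of_eq {φ : CornerMap r} {a : Index r} {p : ℕ × ℕ}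
    (hφ : (φ (a 2) : ℕ × ℕ) = p) (h : ((a 0 : ℕ), (a 1 : ℕ)) = p) : a ∈ cornerSet φ :=
  h.trans hφ.symm

/-- Two elements of a corner set never differ in exactly two components. -/
theorem hammingDist_ne_two (hr : ∀ i, 2 ≤ r i) {φ : CornerMap r} {a b : Index r}
    (ha : a ∈ cornerSet φ) (hb : b ∈ cornerSet φ) : hammingDist a b ≠ 2 := by
  have h0 := hr 0
  have h1 := hr 1
  rw [hammingDist_eq]
  by_cases h2 : a 2 = b 2
  · have h : ((a 0 : ℕ), (a 1 : ℕ)) = ((b 0 : ℕ), (b 1 : ℕ)) := by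
      rw [mem_cornerSet.1 ha, mem_cornerSet.1 hb, h2]
    rw [Prod.mk.injEq] at h
    simp [Subtype.ext h.1, Subtype.ext h.2, h2]
  · rcases corner_cases ha with ⟨-, ha0, ha1⟩ | ⟨-, ha0, ha1⟩ <;>
      rcases corner_cases hb with ⟨-, hb0, hb1⟩ | ⟨-, hb0, hb1⟩ <;>
      simp only [ne_eq, Subtype.ext_iff, ha0, ha1, hb0, hb1] at h2 ⊢ <;> split_ifs <;> omega

/-- The extreme sums 2 and r₁ + r₂ are each attained by only one pair. -/
theorem mem_cornerSet_of_sEquiv {φ : CornerMap r} {a b : Index r} (ha : a ∈ cornerSet φ)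
    (h : (sEquiv r 2) a b) : b ∈ cornerSet φ := by
  obtain ⟨h, h2⟩ := sEquiv_two_iff.1 h
  have hb0 := (b 0).2
  have hb1 := (b 1).2
  simp only [Set.mem_Icc] at hb0 hb1
  rcases corner_cases ha with ⟨hφ, ha0, ha1⟩ | ⟨hφ, ha0, ha1⟩ <;> rw [h2] at hφ <;>
    refine mem_cornerSet_of_eq hφ (Prod.ext ?_ ?_) <;> dsimp only <;> omega

theorem isSwitchable_cornerSet (hr : ∀ i, 2 ≤ r i) (φ : CornerMap r) :
    IsSwitchable 2 t (cornerSet φ) :=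
  ⟨fun _ ha _ hb h => absurd h (hammingDist_ne_two hr ha hb),
    fun _ ha _ => mem_cornerSet_of_sEquiv ha⟩

/-- In a corner set the third component determines the others, so a step of distance 1 changes the
third and nothing else. -/
theorem eq_of_connectedIn {φ : CornerMap r} {a b : Index r} (h : ConnectedIn (cornerSet φ) a b) :
    a 0 = b 0 ∧ a 1 = b 1 := by
  obtain ⟨-, -, h⟩ := h
  induction h with
  | refl => exact ⟨rfl, rfl⟩
  | @tail c d _ hcd ih =>
    rw [ih.1, ih.2]
    obtain ⟨hc, hd, h⟩ := hcd
    rw [hammingDist_eq] at h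
    by_cases h2 : c 2 = d 2
    · have h : ((c 0 : ℕ), (c 1 : ℕ)) = ((d 0 : ℕ), (d 1 : ℕ)) := by
        rw [mem_cornerSet.1 hc, mem_cornerSet.1 hd, h2]
      rw [Prod.mk.injEq] at h
      exact ⟨Subtype.ext h.1, Subtype.ext h.2⟩
    · rw [if_pos h2] at h
      constructor <;> by_contra h' <;> simp [h'] at h

theorem minor_eq_zero_of_eq {a b : Index r} (h : a 0 = b 0 ∧ a 1 = b 1) (i : Fin 3) :
    minor 𝕜 r 2 i a b = 0 := by
  rw [minor]
  simp only [entry_eq_cell]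
  fin_cases i <;> simp [sw, h.1, h.2, mul_comm]

theorem genIdealOn_cornerSet (φ : CornerMap r) : genIdealOn 𝕜 r 2 t (cornerSet φ) = ⊥ := by
  refine Ideal.span_eq_bot.2 ?_
  rintro _ ⟨i, a, b, -, h, rfl⟩
  exact minor_eq_zero_of_eq (eq_of_connectedIn h) i

theorem primeIdeal_cornerSet (φ : CornerMap r) :
    primeIdeal 𝕜 r 2 t (cornerSet φ) = varIdeal 𝕜 r 2 (cornerSet φ) := by
  rw [primeIdeal, genIdealOn_cornerSet]
  exact sup_bot_eq _

theorem varIdeal_eq_span (S : Set (Index r)) :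
    varIdeal 𝕜 r 2 S = Ideal.span (X '' (Quotient.mk (sEquiv r 2) '' Sᶜ)) := by
  rw [varIdeal, Set.image_image]
  congr 1
  ext p
  exact ⟨fun ⟨a, ha, h⟩ => ⟨a, ha, h.symm⟩, fun ⟨a, ha, h⟩ => ⟨a, ha, h.symm⟩⟩

theorem isMonomialIdeal_primeIdeal (φ : CornerMap r) :
    IsMonomialIdeal (primeIdeal 𝕜 r 2 t (cornerSet φ)) := by
  refine ⟨(fun q => Finsupp.single q 1) '' (Quotient.mk (sEquiv r 2) '' (cornerSet φ)ᶜ), ?_⟩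
  rw [primeIdeal_cornerSet, varIdeal_eq_span, Set.image_image (fun m => monomial m (1 : 𝕜))]
  rfl

/-- The ideal generated by a set of variables is the kernel of setting them to zero. -/
theorem span_X_image_eq_ker {σ : Type*} (T : Set σ) [DecidablePred (· ∈ T)] :
    Ideal.span (X '' T) = RingHom.ker
      (aeval fun q => if q ∈ T then 0 else X q : MvPolynomial σ 𝕜 →ₐ[𝕜] MvPolynomial σ 𝕜) := by
  set f := (aeval fun q => if q ∈ T then 0 else X q :
    MvPolynomial σ 𝕜 →ₐ[𝕜] MvPolynomial σ 𝕜) with hf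
  apply le_antisymm
  · refine Ideal.span_le.2 ?_
    rintro _ ⟨q, hq, rfl⟩
    simp [hf, RingHom.mem_ker, hq]
  · have h : (Ideal.Quotient.mkₐ 𝕜 (Ideal.span (X '' T))).comp f =
        Ideal.Quotient.mkₐ 𝕜 (Ideal.span (X '' T)) := by
      ext q
      by_cases hq : q ∈ T
      · have hX : Ideal.Quotient.mk (Ideal.span (X '' T)) (X q : MvPolynomial σ 𝕜) = 0 :=
          Ideal.Quotient.eq_zero_iff_mem.2 (Ideal.subset_span ⟨q, hq, rfl⟩)
        simp [hf, hq, hX]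
      · simp [hf, hq]
    intro p hp
    have := DFunLike.congr_fun h p
    rw [AlgHom.comp_apply, RingHom.mem_ker.1 hp, map_zero] at this
    exact Ideal.Quotient.eq_zero_iff_mem.1 this.symm

theorem isPrime_varIdeal (S : Set (Index r)) : (varIdeal 𝕜 r 2 S).IsPrime := by
  classical
  rw [varIdeal_eq_span, span_X_image_eq_ker]
  exact RingHom.ker_isPrime _

theorem entry_mem_varIdeal_iff {φ : CornerMap r} {a : Index r} :
    entry 𝕜 r 2 a ∈ varIdeal 𝕜 r 2 (cornerSet φ) ↔ a ∉ cornerSet φ := by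
  classical
  refine ⟨fun h ha => ?_, fun h => Ideal.subset_span ⟨a, h, rfl⟩⟩
  rw [varIdeal_eq_span, span_X_image_eq_ker, RingHom.mem_ker, entry, aeval_X, if_neg] at h
  · exact X_ne_zero _ h
  · rintro ⟨b, hb, hab⟩
    exact hb (mem_cornerSet_of_sEquiv ha ((sEquiv r 2).symm (Quotient.exact hab)))

theorem sliceIdeal_le_varIdeal (hr : ∀ i, 2 ≤ r i) (φ : CornerMap r) :
    sliceIdeal 𝕜 r 2 t ≤ varIdeal 𝕜 r 2 (cornerSet φ) := by
  have key : ∀ a b : Index r, hammingDist a b = 2 →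
      entry 𝕜 r 2 a * entry 𝕜 r 2 b ∈ varIdeal 𝕜 r 2 (cornerSet φ) := by
    intro a b h
    by_cases ha : a ∈ cornerSet φ
    · exact Ideal.mul_mem_left _ _ (entry_mem_varIdeal_iff.2 fun hb => hammingDist_ne_two hr ha hb h)
    · exact Ideal.mul_mem_right _ _ (entry_mem_varIdeal_iff.2 ha)
  refine Ideal.span_le.2 ?_
  rintro _ ⟨i, a, b, -, h, rfl⟩
  refine Ideal.sub_mem _ (key a b h) (key _ _ ?_)
  rw [← h, hammingDist_eq, hammingDist_eq]
  fin_cases i <;> simp [sw, eq_comm]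

/-- The first corner `(1, 1, l)`. -/
def firstCorner (hr : ∀ i, 2 ≤ r i) (l : Set.Icc 1 (r 2)) : Index r :=
  mkIndex ⟨1, le_rfl, one_le_two.trans (hr 0)⟩ ⟨1, le_rfl, one_le_two.trans (hr 1)⟩ l

/-- The last corner `(r₁, r₂, l)`. -/
def lastCorner (hr : ∀ i, 2 ≤ r i) (l : Set.Icc 1 (r 2)) : Index r :=
  mkIndex ⟨r 0, one_le_two.trans (hr 0), le_rfl⟩ ⟨r 1, one_le_two.trans (hr 1), le_rfl⟩ l

/-- The point of `S^φ` with third component `l`. -/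
theorem exists_mem_cornerSet (hr : ∀ i, 2 ≤ r i) (φ : CornerMap r) (l : Set.Icc 1 (r 2)) :
    ∃ a ∈ cornerSet φ, a 2 = l := by
  rcases (φ l).2 with h | h
  · exact ⟨firstCorner hr l, mem_cornerSet_of_eq (p := (1, 1)) h rfl, rfl⟩
  · exact ⟨lastCorner hr l, mem_cornerSet_of_eq (p := (r 0, r 1)) h rfl, rfl⟩

/-- The inclusion reverses to one of corner sets, and each of these has a single point in every row.
-/
theorem eq_of_varIdeal_le (hr : ∀ i, 2 ≤ r i) {φ ψ : CornerMap r}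
    (h : varIdeal 𝕜 r 2 (cornerSet φ) ≤ varIdeal 𝕜 r 2 (cornerSet ψ)) : φ = ψ := by
  funext l
  obtain ⟨a, ha, rfl⟩ := exists_mem_cornerSet hr ψ l
  have haφ : a ∈ cornerSet φ := by
    by_contra hn
    exact entry_mem_varIdeal_iff.1 (h (entry_mem_varIdeal_iff.2 hn)) ha
  exact Subtype.ext (haφ.symm.trans ha)

theorem exists_corners {φ : CornerMap r} (hφ : φ.NonConstant) :
    ∃ l l', (φ l : ℕ × ℕ) = (1, 1) ∧ (φ l' : ℕ × ℕ) = (r 0, r 1) := by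
  by_contra! h
  apply hφ
  by_cases h' : ∃ l, (φ l : ℕ × ℕ) = (1, 1)
  · obtain ⟨l, hl⟩ := h'
    exact ⟨⟨(1, 1), Or.inl rfl⟩, fun l' => Subtype.ext ((φ l').2.resolve_right (h l l' hl))⟩
  · push Not at h'
    exact ⟨⟨(r 0, r 1), Or.inr rfl⟩, fun l => Subtype.ext ((φ l).2.resolve_left (h' l))⟩

theorem not_genIdeal_le_varIdeal (hr : ∀ i, 2 ≤ r i) (ht : 1 ≤ t) {φ : CornerMap r}
    (hφ : φ.NonConstant) : ¬ genIdeal 𝕜 r 2 t ≤ varIdeal 𝕜 r 2 (cornerSet φ) := by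
  intro h
  have h0 := hr 0
  obtain ⟨l, l', hl, hl'⟩ := exists_corners hφ
  -- One factor of the switched product lies outside S^φ, so the product of two surviving variables
  -- would lie in the prime.
  have hm := h (Ideal.subset_span ⟨0, firstCorner hr l, lastCorner hr l', ht, rfl⟩)
  have hn : sw {0} (firstCorner hr l) (lastCorner hr l') ∉ cornerSet φ := by
    intro hs
    have hs' : (r 0, 1) = (φ l : ℕ × ℕ) := hs
    rw [hl, Prod.mk.injEq] at hs'
    omega
  rw [minor] at hm
  replace hm := Ideal.add_mem _ hm (Ideal.mul_mem_right
    (entry 𝕜 r 2 (sw {0} (lastCorner hr l') (firstCorner hr l))) _ (entry_mem_varIdeal_iff.2 hn))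
  rw [sub_add_cancel] at hm
  rcases (isPrime_varIdeal _).mem_or_mem hm with hm | hm
  · exact entry_mem_varIdeal_iff.1 hm (mem_cornerSet_of_eq (p := (1, 1)) hl rfl)
  · exact entry_mem_varIdeal_iff.1 hm (mem_cornerSet_of_eq (p := (r 0, r 1)) hl' rfl)

theorem not_varIdeal_le_genIdeal (hr : ∀ i, 2 ≤ r i) {φ : CornerMap r}
    (hφ : φ.NonConstant) : ¬ varIdeal 𝕜 r 2 (cornerSet φ) ≤ genIdeal 𝕜 r 2 t := by
  intro h
  have h0 := hr 0
  obtain ⟨l, l', hl, hl'⟩ := exists_corners hφ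
  have hn : lastCorner hr l ∉ cornerSet φ := by
    intro hs
    have hs' : (r 0, r 1) = (φ l : ℕ × ℕ) := hs
    rw [hl, Prod.mk.injEq] at hs'
    omega
  exact param_entry_ne_zero _ (genIdeal_le_ker_param t (h (entry_mem_varIdeal_iff.2 hn)))

end Corner

/-! ### Classification and count of the minimal primes -/

/-- Every prime containing the slice minors contains one of the claimed minimal primes. -/
theorem exists_le_of_isPrime (hr : ∀ i, 2 ≤ r i) (ht : 1 ≤ t) {Q : Ideal (HankelRing 𝕜 r 2)}
    (hQ : Q.IsPrime) (h : sliceIdeal 𝕜 r 2 t ≤ Q) :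
    genIdeal 𝕜 r 2 t ≤ Q ∨
      ∃ φ : CornerMap r, φ.NonConstant ∧ varIdeal 𝕜 r 2 (cornerSet φ) ≤ Q := by
  classical
  have h0 := hr 0
  have h1 := hr 1
  set f := Ideal.Quotient.mk Q with hfdef
  have hker : RingHom.ker f = Q := Ideal.mk_ker
  have hf : sliceIdeal 𝕜 r 2 t ≤ RingHom.ker f := h.trans_eq hker.symm
  have hM : 4 ≤ r 0 + r 1 := by omega
  have hrow := row_exchange_of_sliceIdeal_le hr ht f hf
  have hgen : Exchange f → genIdeal 𝕜 r 2 t ≤ Q := fun hE =>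
    (genIdeal_le_ker_param t).trans ((ker_param_le hE).trans_eq hker)
  by_cases hex : ∃ l₀, ∀ u ∈ Set.Icc 2 (r 0 + r 1), f (cell 𝕜 u l₀) ≠ 0
  · obtain ⟨l₀, hl₀⟩ := hex
    exact Or.inl (hgen fun l l' u hu v hv => exchange_of_ne_zero hM (fun u l => f (cell 𝕜 u l))
      hrow (consecutive_of_sliceIdeal_le hr ht f hf) hl₀ l l' hu hv)
  have htri : ∀ l, (∀ u ∈ Set.Ioc 2 (r 0 + r 1), f (cell 𝕜 u l) = 0) ∨
      ∀ u ∈ Set.Ico 2 (r 0 + r 1), f (cell 𝕜 u l) = 0 := fun l =>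
    (row_trichotomy hM (fun u => f (cell 𝕜 u l)) (hrow l)).resolve_left fun hl => hex ⟨l, hl⟩
  by_cases hall : ∀ l, ∀ u ∈ Set.Ioc 2 (r 0 + r 1), f (cell 𝕜 u l) = 0
  · left
    refine hgen fun l l' u hu v hv => ?_
    rw [hall l (u + 1) ⟨by have := hu.1; omega, hu.2⟩, hall l' (v + 1) ⟨by have := hv.1; omega, hv.2⟩,
      zero_mul, mul_zero]
  by_cases hall' : ∀ l, ∀ u ∈ Set.Ico 2 (r 0 + r 1), f (cell 𝕜 u l) = 0
  · left
    refine hgen fun l l' u hu v hv => ?_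
    rw [hall' l u hu, hall' l' v hv, zero_mul, mul_zero]
  right
  obtain ⟨l₁, hl₁⟩ := not_forall.1 hall
  obtain ⟨l₂, hl₂⟩ := not_forall.1 hall'
  -- A row that vanishes entirely fits both ends and is assigned (1,1); `l₂` and `l₁` witness the
  -- two values.
  let φ : CornerMap r := fun l =>
    if ∀ u ∈ Set.Ioc 2 (r 0 + r 1), f (cell 𝕜 u l) = 0 then ⟨(1, 1), Or.inl rfl⟩
    else ⟨(r 0, r 1), Or.inr rfl⟩
  have hφ₁ : ∀ l, (∀ u ∈ Set.Ioc 2 (r 0 + r 1), f (cell 𝕜 u l) = 0) → (φ l : ℕ × ℕ) = (1, 1) :=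
    fun l hl => congrArg Subtype.val (if_pos hl)
  have hφ₂ : ∀ l, (¬ ∀ u ∈ Set.Ioc 2 (r 0 + r 1), f (cell 𝕜 u l) = 0) →
      (φ l : ℕ × ℕ) = (r 0, r 1) := fun l hl => congrArg Subtype.val (if_neg hl)
  refine ⟨φ, ?_, ?_⟩
  · rintro ⟨c, hc⟩
    have e := hφ₁ l₂ ((htri l₂).resolve_right hl₂)
    have e' := hφ₂ l₁ hl₁
    rw [hc, ← hc l₁, e', Prod.mk.injEq] at e
    omega
  · refine Ideal.span_le.2 ?_
    rintro _ ⟨a, ha, rfl⟩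
    have ha0 := (a 0).2
    have ha1 := (a 1).2
    simp only [Set.mem_Icc] at ha0 ha1
    rw [SetLike.mem_coe, ← Ideal.Quotient.eq_zero_iff_mem, entry_eq_cell]
    by_cases hl : ∀ u ∈ Set.Ioc 2 (r 0 + r 1), f (cell 𝕜 u (a 2)) = 0
    · refine hl _ ⟨?_, by omega⟩
      by_contra hlt
      exact ha (mem_cornerSet_of_eq (hφ₁ _ hl) (Prod.ext (by dsimp only; omega) (by dsimp only; omega)))
    · refine (htri (a 2)).resolve_left hl _ ⟨by omega, ?_⟩
      by_contra hlt
      exact ha (mem_cornerSet_of_eq (hφ₂ _ hl) (Prod.ext (by dsimp only; omega) (by dsimp only; omega)))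

theorem ncard_nonConstant (hr : ∀ i, 2 ≤ r i) :
    {φ : CornerMap r | φ.NonConstant}.ncard = 2 ^ r 2 - 2 := by
  classical
  have h0 := hr 0
  have h2 := hr 2
  have hcard : Nat.card ({(1, 1), (r 0, r 1)} : Set (ℕ × ℕ)) = 2 := by
    rw [Nat.card_coe_set_eq, Set.ncard_pair]
    rw [ne_eq, Prod.mk.injEq]
    omega
  have : Nonempty (Set.Icc 1 (r 2)) := ⟨⟨1, le_rfl, by omega⟩⟩
  have hcompl : {φ : CornerMap r | φ.NonConstant} =
      (Set.range (Function.const (Set.Icc 1 (r 2)) : _ → CornerMap r))ᶜ := by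
    ext φ
    refine not_congr ⟨fun ⟨c, hc⟩ => ⟨c, funext fun l => (hc l).symm⟩, ?_⟩
    rintro ⟨c, rfl⟩
    exact ⟨c, fun _ => rfl⟩
  -- The two constant maps are distinct because r₁ ≥ 2 and there is at least one row.
  rw [hcompl, Set.ncard_compl, ← Set.image_univ,
    Set.ncard_image_of_injective _ Function.const_injective, Set.ncard_univ, hcard,
    Nat.card_fun, hcard]
  simp

theorem minimalPrimes_sliceIdeal (hr : ∀ i, 2 ≤ r i) (ht : 1 ≤ t) :
    (sliceIdeal 𝕜 r 2 t).minimalPrimes = insert (genIdeal 𝕜 r 2 t)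
      ((fun φ => varIdeal 𝕜 r 2 (cornerSet φ)) '' {φ : CornerMap r | φ.NonConstant}) := by
  ext P
  constructor
  · rintro ⟨⟨hP, hle⟩, hmin⟩
    rcases exists_le_of_isPrime hr ht hP hle with h | ⟨φ, hφ, h⟩
    · exact Or.inl ((hmin ⟨isPrime_genIdeal hr ht, sliceIdeal_le_genIdeal⟩ h).antisymm h)
    · exact Or.inr ⟨φ, hφ, h.antisymm
        (hmin ⟨isPrime_varIdeal _, sliceIdeal_le_varIdeal hr φ⟩ h)⟩
  · rintro (rfl | ⟨φ, hφ, rfl⟩)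
    · refine ⟨⟨isPrime_genIdeal hr ht, sliceIdeal_le_genIdeal⟩, fun Q hQ hQle => ?_⟩
      rcases exists_le_of_isPrime hr ht hQ.1 hQ.2 with h | ⟨φ, hφ, h⟩
      · exact h
      · exact absurd (h.trans hQle) (not_varIdeal_le_genIdeal hr hφ)
    · refine ⟨⟨isPrime_varIdeal _, sliceIdeal_le_varIdeal hr φ⟩, fun Q hQ hQle => ?_⟩
      rcases exists_le_of_isPrime hr ht hQ.1 hQ.2 with h | ⟨ψ, hψ, h⟩
      · exact absurd (h.trans hQle) (not_genIdeal_le_varIdeal hr ht hφ)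
      · exact (eq_of_varIdeal_le hr (h.trans hQle)) ▸ h

theorem ncard_minimalPrimes_sliceIdeal (hr : ∀ i, 2 ≤ r i) (ht : 1 ≤ t) :
    (sliceIdeal 𝕜 r 2 t).minimalPrimes.ncard = 2 ^ r 2 - 1 := by
  rw [minimalPrimes_sliceIdeal hr ht, Set.ncard_insert_of_notMem,
    Set.ncard_image_of_injective _ fun φ ψ h => eq_of_varIdeal_le hr (le_of_eq h),
    ncard_nonConstant hr]
  · have := Nat.pow_le_pow_right two_pos ((one_le_two).trans (hr 2))
    omega
  · rintro ⟨φ, hφ, h⟩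
    exact not_varIdeal_le_genIdeal hr hφ h.le

end HankelHypermatrix

open HankelHypermatrix
theorem mainTheorem9 (𝕜 : Type*) [Field 𝕜] (r : Fin 3 → ℕ) (hr : ∀ i, 2 ≤ r i)
    (t : ℕ) (ht : 1 ≤ t) (ht' : t ≤ 3) :
    (sliceIdeal 𝕜 r 2 t).minimalPrimes =
        {genIdeal 𝕜 r 2 t} ∪
          {P | ∃ φ : CornerMap r, φ.NonConstant ∧ P = primeIdeal 𝕜 r 2 t (cornerSet φ)} ∧
      (sliceIdeal 𝕜 r 2 t).minimalPrimes.ncard = 2 ^ r 2 - 1 ∧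
      ∀ φ : CornerMap r, φ.NonConstant →
        IsSwitchable 2 t (cornerSet φ) ∧
          IsMonomialIdeal (primeIdeal 𝕜 r 2 t (cornerSet φ)) := by
  refine ⟨?_, ncard_minimalPrimes_sliceIdeal hr ht, fun φ _ =>
    ⟨isSwitchable_cornerSet hr φ, isMonomialIdeal_primeIdeal φ⟩⟩
  rw [minimalPrimes_sliceIdeal hr ht, Set.insert_eq]
  congr 1
  ext P
  exact ⟨fun ⟨φ, hφ, h⟩ => ⟨φ, hφ, h.symm.trans (primeIdeal_cornerSet φ).symm⟩,
    fun ⟨φ, hφ, h⟩ => ⟨φ, hφ, (h.trans (primeIdeal_cornerSet φ)).symm⟩⟩
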